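/- All topological spaces are assumed to be Hausdorff. A \emph{topological J-group} $(G,w,f)$ consists of a topological group $G$, an element $w\in G$ (the \emph{witness}) and a continuous map $f\colon G\to G$ such that $f(x\cdot w)=f(x)\cdot x$ for all $x\in G$; one says that $G$ is a topological J-group with witness $w$ if such an $f$ exists. Let $\mathbb K$ be a topological field of characteristic $0$ and let $\mathfrak g$ be a nilpotent topological Lie algebra over $\mathbb K$ (of arbitrary dimension), i.e. a nilpotent Lie algebra with a topology making it a topological $\mathbb K$-vector space with jointly continuous Lie bracket. For $x,y\in\mathfrak g$ let $$x*y=\sum_{n\ge 1}\ \sum_{k=1}^{n}\frac{(-1)^{k-1}}{k}\sum_{\substack{r_i,s_i\ge 0,\ r_i+s_i>0\\ \sum_{i=1}^k(r_i+s_i)=n}}\frac{[x^{r_1}y^{s_1}\cdots x^{r_k}y^{s_k}]}{n\,r_1!\,s_1!\cdots r_k!\,s_k!}=x+y+\tfrac12[x,y]+\cdots$$ be the Baker-Campbell-Hausdorff series, where $[a_1a_2\cdots a_n]$ denotes the iterated bracket $[a_1,[a_2,[\cdots,[a_{n-1},a_n]\cdots]]]$ (and $a_1$ if $n=1$); the sum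 is finite because $\mathfrak g$ is nilpotent. \textbf{Theorem.} Let $w$ be an element of the center of $\mathfrak g$ and suppose that there is a continuous map $\varphi\colon\mathfrak g\to\mathbb K$ with $\varphi(x+w)=\varphi(x)+1$ for all $x\in\mathfrak g$. Then $(\mathfrak g,*)$, with the given topology, is a topological group with neutral element $0$ and inversion $x\mapsto -x$, and it is a topological J-group with witness $w$. -/

import Mathlib

/-- A topological J-group `(G, w, f)`: a Hausdorff topological group `G`, an element `w` (the
witness) and a continuous self-map `f` such that `f (x * w) = f x * x` for all `x`. -/
structure IsTopologicalJGroup (G : Type*) [Group G] [TopologicalSpace G] (w : G) (f : G → G) :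
    Prop where
  isTopologicalGroup : IsTopologicalGroup G
  t2Space : T2Space G
  continuous_map : Continuous f
  map_mul_witness : ∀ x : G, f (x * w) = f x * x

/-- A topological Lie algebra over the topological field `K`: a topological vector space whose Lie
bracket is jointly continuous. -/
class IsTopologicalLieAlgebra (K g : Type*) [Field K] [TopologicalSpace K] [LieRing g]
    [LieAlgebra K g] [TopologicalSpace g] : Prop where
  isTopologicalAddGroup : IsTopologicalAddGroup g
  continuousSMul : ContinuousSMul K g
  continuous_lie : Continuous fun p : g × g => ⁅p.1, p.2⁆

/-- The iterated bracket `[a₁, [a₂, [⋯, [aₘ₋₁, aₘ]⋯]]]` of a word `a₁ a₂ ⋯ aₘ`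
(equal to `a₁` if `m = 1`; the empty word gets the value `0`). -/
def iteratedBracket {g : Type*} [LieRing g] : List g → g
  | [] => 0
  | [a] => a
  | a :: b :: l => ⁅a, iteratedBracket (b :: l)⁆

/-- The word `x ⋯ x y ⋯ y x ⋯ x y ⋯ y ⋯` consisting of `k` blocks, where the `i`-th block is
`x` repeated `(p i).1` times followed by `y` repeated `(p i).2` times. -/
def blockWord {g : Type*} {k : ℕ} (p : Fin k → ℕ × ℕ) (x y : g) : List g :=
  (List.ofFn fun i => List.replicate (p i).1 x ++ List.replicate (p i).2 y).flatten

/-- The tuples `((r₁, s₁), …, (rₖ, sₖ))` of pairs of natural numbers with `rᵢ + sᵢ > 0` for all `i`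
and `∑ i, (rᵢ + sᵢ) = n`. -/
def bchIndex (n k : ℕ) : Finset (Fin k → ℕ × ℕ) :=
  (Fintype.piFinset fun _ : Fin k => Finset.range (n + 1) ×ˢ Finset.range (n + 1)).filter
    fun p => (∀ i, 0 < (p i).1 + (p i).2) ∧ ∑ i, ((p i).1 + (p i).2) = n

/-- The homogeneous component of degree `n` of the Baker-Campbell-Hausdorff series
`log (exp x * exp y)`, in Dynkin's form
`∑ₖ (-1)ᵏ⁻¹ / k ∑ [x^r₁ y^s₁ ⋯ x^rₖ y^sₖ] / (n r₁! s₁! ⋯ rₖ! sₖ!)`. -/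
noncomputable def bchTerm (K : Type*) {g : Type*} [Field K] [LieRing g] [LieAlgebra K g]
    (n : ℕ) (x y : g) : g :=
  ∑ k ∈ Finset.Icc 1 n, ∑ p ∈ bchIndex n k,
    ((-1 : K) ^ (k - 1) /
      ((k : K) * (n : K) * ∏ i, (((p i).1.factorial : K) * ((p i).2.factorial : K)))) •
      iteratedBracket (blockWord p x y)

/-- The Baker-Campbell-Hausdorff multiplication on a nilpotent Lie algebra over a field of
characteristic zero. The sum is finite, see `finite_support_bchTerm`. -/
noncomputable def bchMul (K : Type*) {g : Type*} [Field K] [LieRing g] [LieAlgebra K g]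
    (x y : g) : g :=
  ∑ᶠ n : ℕ, bchTerm K n x y

theorem iteratedBracket_mem_lowerCentralSeries (K : Type*) {g : Type*} [Field K] [LieRing g]
    [LieAlgebra K g] (l : List g) :
    iteratedBracket l ∈ LieModule.lowerCentralSeries K g g (l.length - 1) := by
  induction l with
  | nil => simp [iteratedBracket]
  | cons a l ih =>
    cases l with
    | nil => simp [iteratedBracket]
    | cons b l =>
      simp only [iteratedBracket, List.length_cons, Nat.add_sub_cancel,
        LieModule.lowerCentralSeries_succ] at ih ⊢
      exact LieSubmodule.lie_mem_lie (LieSubmodule.mem_top a) ih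

theorem length_blockWord {g : Type*} {k : ℕ} (p : Fin k → ℕ × ℕ) (x y : g) :
    (blockWord p x y).length = ∑ i, ((p i).1 + (p i).2) := by
  simp [blockWord, List.length_flatten, List.map_ofFn, List.sum_ofFn]

/-- On a nilpotent Lie algebra only finitely many terms of the series are non-zero. -/
theorem finite_support_bchTerm (K : Type*) {g : Type*} [Field K] [LieRing g] [LieAlgebra K g]
    [LieRing.IsNilpotent g] (x y : g) :
    (Function.support fun n : ℕ => bchTerm K n x y).Finite := by
  obtain ⟨N, hN⟩ := LieModule.IsNilpotent.nilpotent K g g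
  refine (Set.finite_Iic N).subset fun n hn => ?_
  by_contra hlt
  refine hn (Finset.sum_eq_zero fun k _ => Finset.sum_eq_zero fun p hp => ?_)
  have hlen : (blockWord p x y).length = n := by
    rw [length_blockWord]
    exact (Finset.mem_filter.mp hp).2.2
  have hmem := iteratedBracket_mem_lowerCentralSeries K (blockWord p x y)
  have hle : N ≤ (blockWord p x y).length - 1 := by
    have h : ¬ n ≤ N := hlt
    omega
  have h0 := LieModule.antitone_lowerCentralSeries K g g hle hmem
  rw [hN, LieSubmodule.mem_bot] at h0
  rw [h0, smul_zero]

/-!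
The substance of the theorem is that Dynkin's formula defines an associative multiplication. Write
`x * y` for it. The proof uses neither free Lie algebras nor the Poincaré-Birkhoff-Witt theorem, and
works over `ℚ`, since the coefficients of the series are rational.

*Associative algebras.* Let `x` and `y` lie in the first step of a multiplicative filtration of
finite length on an associative `ℚ`-algebra. Then `exp (x * y) = exp x * exp y` (`BCH.exp_bchMul`).
Let `D` be a derivation with `D x = x` and `D y = y`. It multiplies a bracket of `n` letters by `n`,
so it cancels the weights `1 / n` in Dynkin's formula. What remains is a geometric expression in
`exp (ad x) * exp (ad y)` applied to the logarithmic derivative `x + exp (ad x) y` of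
`u = exp x * exp y` (`BCH.sum_natCast_smul_bchTerm`), and this is `D (log u)`
(`BCH.derivation_nilLog`). Such a `D` exists after `x` and `y` are multiplied by a central variable
`X`: the Euler derivation `X d/dX`, which is injective on polynomials without constant term. Hence
`x * y = log u` over the polynomial ring, and `X = 1` gives the claim. As `exp` is injective on
nilpotent elements, the multiplication is associative there (`BCH.bchMul_assoc_of_nilFiltration`).

Identities between logarithms and exponentials are obtained by comparing linear coefficients: powers
`u ^ n` of a unipotent element are polynomials in `n` with linear coefficient `log u`
(`BCH.sum_coeff_smul_eq`).

*Nilpotent Lie algebras.* The adjoint representation of a nilpotent Lie algebra `g` forgets the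
center. It is replaced by the action of the Lie algebra `ℚ[X] ⊗ g` of polynomial curves on its
semidirect product with the line spanned by `d/dX` (`BCH.curveRep`), which is filtered by the lower
central series and determines the derivative of a curve. So both ways of multiplying the curves
`X ⊗ x`, `X ⊗ y`, `X ⊗ z` have the same derivative. They agree at `0`, hence also at `1`, which is
associativity in `g` (`BCH.bchMul_assoc`).

*The group.* If `x` and `y` commute then `x * y = x + y`; this gives the neutral element, the
inverses, and `x * w = x + w` for central `w`. Continuity holds because the series has uniformly
bounded length. Finally `f x = φ x • x - (φ x * (φ x + 1) / 2) • w` commutes with `x`, and it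
satisfies `f (x + w) = f x + x`.
-/

namespace BCH

open Polynomial Finset TensorProduct

/-! ### Binomial polynomials and coefficient comparison -/

/-- The polynomial `X (X - 1) ⋯ (X - k + 1) / k!`, with value `n.choose k` at `n`. -/
noncomputable def choosePoly (k : ℕ) : ℚ[X] := C ((k.factorial : ℚ)⁻¹) * descPochhammer ℚ k

theorem choosePoly_eval (k n : ℕ) : (choosePoly k).eval (n : ℚ) = n.choose k := by
  rw [choosePoly, eval_mul, eval_C, descPochhammer_eval_eq_descFactorial,
    Nat.descFactorial_eq_factorial_mul_choose, Nat.cast_mul,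
    inv_mul_cancel_left₀ (by exact_mod_cast k.factorial_ne_zero)]

theorem choosePoly_zero : choosePoly 0 = 1 := by simp [choosePoly]

theorem choosePoly_coeff_zero_succ (k : ℕ) : (choosePoly (k + 1)).coeff 0 = 0 := by
  simp [choosePoly, descPochhammer_succ_left]

theorem descPochhammer_eval_neg_one (k : ℕ) :
    (descPochhammer ℚ k).eval (-1) = (-1) ^ k * k.factorial := by
  induction k with
  | zero => simp
  | succ k ih =>
    rw [descPochhammer_succ_right, eval_mul, ih, Nat.factorial_succ]
    simp
    ring

/-- The coefficients of the logarithm series are the linear coefficients of the binomial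
polynomials: the derivative of `(1 + z) ^ s` at `s = 0` is `log (1 + z)`. -/
theorem choosePoly_coeff_one (k : ℕ) : (choosePoly k).coeff 1 = (-1) ^ (k - 1) / k := by
  cases k with
  | zero => simp [choosePoly, coeff_one]
  | succ k =>
    have hk : (k.factorial : ℚ) ≠ 0 := by exact_mod_cast k.factorial_ne_zero
    have hk' : (k : ℚ) + 1 ≠ 0 := by positivity
    have h : (descPochhammer ℚ (k + 1)).coeff 1 = (-1) ^ k * k.factorial := by
      rw [descPochhammer_succ_left, ← descPochhammer_eval_neg_one, coeff_X_mul,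
        coeff_zero_eq_eval_zero, eval_comp]
      simp
    rw [choosePoly, coeff_C_mul, h, Nat.factorial_succ]
    push_cast [Nat.add_sub_cancel]
    field_simp

/-- A vector-valued polynomial that vanishes at all natural numbers has zero coefficients. -/
theorem sum_coeff_smul_eq_zero {V ι : Type*} [AddCommGroup V] [Module ℚ V] (s : Finset ι)
    (p : ι → ℚ[X]) (v : ι → V) (h : ∀ n : ℕ, ∑ i ∈ s, (p i).eval (n : ℚ) • v i = 0) (j : ℕ) :
    ∑ i ∈ s, (p i).coeff j • v i = 0 := by
  refine (Module.forall_dual_apply_eq_zero_iff ℚ _).1 fun f => ?_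
  have h0 : ∑ i ∈ s, C (f (v i)) * p i = 0 := by
    refine Polynomial.eq_zero_of_infinite_isRoot _ ?_
    refine (Set.infinite_range_of_injective (Nat.cast_injective (R := ℚ))).mono ?_
    rintro _ ⟨n, rfl⟩
    have := congrArg f (h n)
    simp only [map_sum, map_smul, map_zero, smul_eq_mul] at this
    simpa [IsRoot.def, eval_finsetSum, mul_comm] using this
  have := congrArg (fun q => coeff q j) h0
  simpa [finsetSum_coeff, mul_comm] using this

theorem sum_coeff_smul_eq {V ι κ : Type*} [AddCommGroup V] [Module ℚ V] (s : Finset ι)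
    (t : Finset κ) (p : ι → ℚ[X]) (q : κ → ℚ[X]) (v : ι → V) (w : κ → V)
    (h : ∀ n : ℕ, ∑ i ∈ s, (p i).eval (n : ℚ) • v i = ∑ i ∈ t, (q i).eval (n : ℚ) • w i) (j : ℕ) :
    ∑ i ∈ s, (p i).coeff j • v i = ∑ i ∈ t, (q i).coeff j • w i := by
  have := sum_coeff_smul_eq_zero (s.disjSum t) (Sum.elim p fun i => -q i) (Sum.elim v w)
    (fun n => by simp [Finset.sum_disjSum, h n]) j
  simpa [Finset.sum_disjSum, add_neg_eq_zero] using this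

/-! ### The logarithm of a unipotent element -/

section Log

variable {R : Type*} [Ring R] [Algebra ℚ R]

/-- The logarithm `∑ (-1)ᵏ⁻¹ / k * (u - 1)ᵏ` of a unipotent element `u`. The term with `k = 0`
vanishes because of the division by zero. -/
noncomputable def nilLog (u : R) : R :=
  ∑ k ∈ range (nilpotencyClass (u - 1)), (choosePoly k).coeff 1 • (u - 1) ^ k

theorem nilLog_eq_sum {u : R} {N : ℕ} (h : (u - 1) ^ N = 0) :
    nilLog u = ∑ k ∈ range N, (choosePoly k).coeff 1 • (u - 1) ^ k := by
  refine Finset.sum_subset (range_mono (csInf_le' h)) fun k _ hk => ?_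
  rw [pow_eq_zero_of_le (by simpa using hk) (pow_nilpotencyClass ⟨N, h⟩), smul_zero]

theorem pow_eq_sum_choose {u : R} {N : ℕ} (h : (u - 1) ^ N = 0) (n : ℕ) :
    u ^ n = ∑ k ∈ range N, (choosePoly k).eval (n : ℚ) • (u - 1) ^ k := by
  have h1 : u ^ n = ∑ k ∈ range (n + 1), (choosePoly k).eval (n : ℚ) • (u - 1) ^ k := by
    conv_lhs => rw [← sub_add_cancel u 1, (Commute.one_right (u - 1)).add_pow]
    refine sum_congr rfl fun k _ => ?_
    rw [choosePoly_eval, one_pow, mul_one, Nat.cast_smul_eq_nsmul, nsmul_eq_mul, Nat.cast_comm]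
  rw [h1]
  have h2 : ∀ M, n + 1 ≤ M ∨ N ≤ M → M ≤ n + 1 + N →
      ∑ k ∈ range M, (choosePoly k).eval (n : ℚ) • (u - 1) ^ k =
      ∑ k ∈ range (n + 1 + N), (choosePoly k).eval (n : ℚ) • (u - 1) ^ k := by
    intro M hM hM'
    refine sum_subset (range_mono hM') fun k _ hk => ?_
    have hk : M ≤ k := by simpa using hk
    rcases hM with hM | hM
    · rw [choosePoly_eval, Nat.choose_eq_zero_of_lt (by omega), Nat.cast_zero, zero_smul]
    · rw [pow_eq_zero_of_le (hM.trans hk) h, smul_zero]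
  rw [h2 _ (Or.inl le_rfl) (by omega), ← h2 N (Or.inr le_rfl) (by omega)]

theorem exp_pow {a : R} (ha : IsNilpotent a) (n : ℕ) :
    IsNilpotent.exp a ^ n = IsNilpotent.exp ((n : ℚ) • a) := by
  induction n with
  | zero => simp
  | succ n ih =>
    rw [pow_succ, ih, Nat.cast_succ, add_smul, one_smul,
      IsNilpotent.exp_add_of_commute ((Commute.refl a).smul_left _) (ha.smul _) ha]

/-- Both sides are the linear coefficients in `n` of `exp a ^ n = exp (n • a)`. -/
theorem nilLog_exp {a : R} (ha : IsNilpotent a) : nilLog (IsNilpotent.exp a) = a := by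
  obtain ⟨N, hN⟩ := IsNilpotent.isNilpotent_exp_sub_one ha
  obtain ⟨M, hM⟩ := ha
  have hM2 : a ^ (M + 2) = 0 := pow_eq_zero_of_le (by omega) hM
  rw [nilLog_eq_sum hN]
  have := sum_coeff_smul_eq (range N) (range (M + 2)) choosePoly (fun i => X ^ i)
    (fun k => (IsNilpotent.exp a - 1) ^ k) (fun i => (i.factorial : ℚ)⁻¹ • a ^ i)
    (fun n => by
      rw [← pow_eq_sum_choose hN n, exp_pow ⟨M, hM⟩ n,
        IsNilpotent.exp_eq_sum (k := M + 2) (by rw [_root_.smul_pow, hM2, smul_zero])]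
      refine sum_congr rfl fun i _ => ?_
      rw [_root_.smul_pow, eval_pow, eval_X, smul_comm]) 1
  rw [this, sum_eq_single 1]
  · simp
  · intro i _ hi
    rw [coeff_X_pow, if_neg (Ne.symm hi), zero_smul]
  · simp

theorem exp_injOn_nilpotent {a b : R} (ha : IsNilpotent a) (hb : IsNilpotent b)
    (h : IsNilpotent.exp a = IsNilpotent.exp b) : a = b := by
  rw [← nilLog_exp ha, h, nilLog_exp hb]

theorem isNilpotent_nilLog {u : R} (hu : IsNilpotent (u - 1)) : IsNilpotent (nilLog u) := by
  refine Commute.isNilpotent_sum (fun k _ => ?_) fun i j _ _ =>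
    (((Commute.refl (u - 1)).pow_pow i j).smul_left _).smul_right _
  rcases k with _ | k
  · simp [choosePoly_coeff_one]
  · exact (hu.pow_succ k).smul _

/-- For commuting nilpotent `a` and `b`, the difference of `∑ cₖ aᵏ` and `∑ cₖ bᵏ` is `a - b` times
`c₁` plus a nilpotent element. -/
theorem eq_of_commute_of_nilLog_eq {u w : R} (huw : Commute u w) (hu : IsNilpotent (u - 1))
    (hw : IsNilpotent (w - 1)) (h : nilLog u = nilLog w) : u = w := by
  obtain ⟨M, hM⟩ := hu
  obtain ⟨M', hM'⟩ := hw
  set a := u - 1 with ha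
  set b := w - 1 with hb
  have hab : Commute a b := (huw.sub_left (Commute.one_left w)).sub_right (Commute.one_right _)
  rw [nilLog_eq_sum (pow_eq_zero_of_le (show M ≤ M + M' + 2 by omega) hM),
    nilLog_eq_sum (pow_eq_zero_of_le (show M' ≤ M + M' + 2 by omega) hM'),
    ← sub_eq_zero, ← sum_sub_distrib, sum_range_succ', sum_range_succ'] at h
  simp only [← smul_sub, ← ha, ← hb, pow_zero, sub_self, add_zero, zero_add, pow_one]
    at h
  rw [choosePoly_coeff_one 1] at h
  set r : R := ∑ k ∈ range (M + M'), (choosePoly (k + 1 + 1)).coeff 1 •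
    ∑ i ∈ range (k + 1 + 1), a ^ i * b ^ (k + 1 + 1 - 1 - i) with hr
  have hca : ∀ i j i' j', Commute (a ^ i * b ^ j) (a ^ i' * b ^ j') := fun i j i' j' =>
    ((((Commute.refl a).pow_pow i i').mul_right (hab.pow_pow i j'))).mul_left
      ((hab.symm.pow_pow j i').mul_right ((Commute.refl b).pow_pow j j'))
  have hnil : IsNilpotent r := by
    refine Commute.isNilpotent_sum (fun k _ => IsNilpotent.smul ?_ _) fun k l _ _ => ?_
    · refine Commute.isNilpotent_sum (fun i _ => ?_) fun i j _ _ => hca _ _ _ _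
      rcases i with _ | i
      · rw [pow_zero, one_mul]
        exact IsNilpotent.pow_of_pos ⟨M', hM'⟩ (by omega)
      · exact (hab.pow_pow _ _).isNilpotent_mul_right (IsNilpotent.pow_succ _ ⟨M, hM⟩)
    · refine ((Commute.sum_left _ _ _ fun i _ => Commute.sum_right _ _ _ fun j _ =>
        hca _ _ _ _).smul_left _).smul_right _
  have h2 : (a - b) * (r + 1) = 0 := by
    rw [mul_add, mul_one, hr, mul_sum, ← h]
    congr 1
    · refine sum_congr rfl fun k _ => ?_
      rw [mul_smul_comm, hab.mul_geom_sum₂]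
    · simp
  have h3 := hnil.isUnit_add_one.mul_left_eq_zero.1 h2
  rw [ha, hb, sub_sub_sub_cancel_right] at h3
  exact sub_eq_zero.1 h3

/-- Both sides are unipotent with logarithm `nilLog u`, and they commute. -/
theorem exp_nilLog {u : R} (hu : IsNilpotent (u - 1)) : IsNilpotent.exp (nilLog u) = u := by
  have hlog := isNilpotent_nilLog hu
  refine eq_of_commute_of_nilLog_eq ?_ (IsNilpotent.isNilpotent_exp_sub_one hlog) hu
    (nilLog_exp hlog)
  have h1 : Commute u (u - 1) := (Commute.refl u).sub_right (Commute.one_right u)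
  have h2 : Commute u (nilLog u) := Commute.sum_right _ _ _ fun k _ => (h1.pow_right k).smul_right _
  exact (Commute.sum_right _ _ _ fun k _ => (h2.pow_right k).smul_right _).symm

/-- The derivative of a logarithm: if `θ = D u * u⁻¹` is the logarithmic derivative of `u` and `S`
is conjugation by `u` minus the identity, then `D (log u) = ∑ cₖ₊₁ Sᵏ θ`, where `cₖ` are the
coefficients of the logarithm series. Both sides are the linear coefficients in `n` of `D (u ^ n)`.
-/
theorem derivation_nilLog (D : R →ₗ[ℚ] R) (hD : ∀ a b, D (a * b) = D a * b + a * D b) {u v : R}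
    (hvu : v * u = 1) {N : ℕ} (hu : (u - 1) ^ N = 0) (S : Module.End ℚ R)
    (hS : ∀ r, S r = u * r * v - r) (hSθ : (S ^ N) (D u * v) = 0) :
    D (nilLog u) = ∑ k ∈ range N, (choosePoly (k + 1)).coeff 1 • (S ^ k) (D u * v) := by
  set θ := D u * v with hθ
  have hD1 : D 1 = 0 := by simpa using hD 1 1
  have hpow : ∀ n : ℕ, D (u ^ n) =
      (∑ k ∈ range N, (choosePoly (k + 1)).eval (n : ℚ) • (S ^ k) θ) * u ^ n := by
    intro n
    induction n with
    | zero =>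
      rw [pow_zero, hD1, mul_one, eq_comm]
      refine sum_eq_zero fun k _ => ?_
      rw [choosePoly_eval, Nat.choose_zero_succ, Nat.cast_zero, zero_smul]
    | succ n ih =>
      set G := ∑ k ∈ range N, (choosePoly (k + 1)).eval (n : ℚ) • (S ^ k) θ with hG
      have hrec : ∑ k ∈ range N, (choosePoly (k + 1)).eval ((n + 1 : ℕ) : ℚ) • (S ^ k) θ =
          θ + S G + G := by
        have h1 : ∑ k ∈ range N, (choosePoly (k + 1)).eval ((n + 1 : ℕ) : ℚ) • (S ^ k) θ =
            ∑ k ∈ range N, ((n.choose k : ℕ) : ℚ) • (S ^ k) θ + G := by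
          rw [hG, ← sum_add_distrib]
          refine sum_congr rfl fun k _ => ?_
          rw [choosePoly_eval, choosePoly_eval, Nat.choose_succ_succ, Nat.cast_add, add_smul]
        have h2 : ∑ k ∈ range (N + 1), ((n.choose k : ℕ) : ℚ) • (S ^ k) θ = θ + S G := by
          rw [sum_range_succ', add_comm, hG, map_sum]
          simp [choosePoly_eval, pow_succ', -map_sum]
        rw [h1, ← h2, sum_range_succ, hSθ, smul_zero, add_zero]
      have hθu : θ * u = D u := by rw [hθ, mul_assoc, hvu, mul_one]
      rw [hrec, pow_succ', hD, ih, hS, ← hθu]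
      have : u * G * v * (u * u ^ n) = u * (G * u ^ n) := by
        rw [← mul_assoc _ u, mul_assoc _ v, hvu, mul_one, mul_assoc]
      rw [add_assoc, sub_add_cancel, add_mul, this, mul_assoc]
  have hu' : (u - 1) ^ (N + 1) = 0 := pow_eq_zero_of_le N.le_succ hu
  have h := sum_coeff_smul_eq (range N) (range N ×ˢ range (N + 1)) choosePoly
    (fun i => choosePoly (i.1 + 1) * choosePoly i.2) (fun k => D ((u - 1) ^ k))
    (fun i => (S ^ i.1) θ * (u - 1) ^ i.2)
    (fun n => by
      have h1 := hpow n
      nth_rewrite 1 [pow_eq_sum_choose hu n] at h1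
      rw [pow_eq_sum_choose hu' n, map_sum] at h1
      simp only [map_smul] at h1
      rw [h1, sum_mul_sum, sum_product]
      simp only [eval_mul, smul_mul_smul_comm]) 1
  rw [nilLog_eq_sum hu, map_sum]
  simp only [map_smul]
  rw [h, sum_product]
  refine sum_congr rfl fun k _ => ?_
  rw [sum_range_succ', sum_eq_zero fun l _ => ?_]
  · rw [zero_add, mul_coeff_one, choosePoly_zero]
    simp [choosePoly_coeff_zero_succ]
  · rw [mul_coeff_one, choosePoly_coeff_zero_succ, choosePoly_coeff_zero_succ, zero_mul, mul_zero,
      add_zero, zero_smul]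

end Log

/-! ### Dynkin's formula in terms of the adjoint representation -/

section Dynkin

variable {L : Type*} [LieRing L] [LieAlgebra ℚ L]

theorem iteratedBracket_append (l : List L) {m : List L} (hm : m ≠ []) :
    iteratedBracket (l ++ m) = ((l.map (LieAlgebra.ad ℚ L)).prod) (iteratedBracket m) := by
  induction l with
  | nil => simp
  | cons a l ih =>
    obtain ⟨b, t, hbt⟩ := List.exists_cons_of_ne_nil (List.append_ne_nil_of_right_ne_nil l hm)
    rw [List.cons_append, hbt, iteratedBracket, ← hbt, ih]
    simp

theorem iteratedBracket_replicate_add_two {L : Type*} [LieRing L] (x : L) (n : ℕ) :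
    iteratedBracket (List.replicate (n + 2) x) = 0 := by
  induction n with
  | zero => simp [List.replicate, iteratedBracket]
  | succ n ih =>
    rw [List.replicate_succ]
    rw [List.replicate_succ] at ih ⊢
    rw [iteratedBracket, ih, lie_zero]

/-- The pairs of exponents `(r, s) ≠ (0, 0)` with `r, s < N`. -/
def expBox (N : ℕ) : Finset (ℕ × ℕ) := (range N ×ˢ range N).filter fun a => 0 < a.1 + a.2

theorem mem_expBox {N : ℕ} {a : ℕ × ℕ} :
    a ∈ expBox N ↔ (a.1 < N ∧ a.2 < N) ∧ 0 < a.1 + a.2 := by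
  simp [expBox]

theorem sum_range_product_eq_add_expBox {V : Type*} [AddCommMonoid V] {N : ℕ} (hN : 0 < N)
    (f : ℕ × ℕ → V) : ∑ a ∈ range N ×ˢ range N, f a = f (0, 0) + ∑ a ∈ expBox N, f a := by
  have : range N ×ˢ range N = insert (0, 0) (expBox N) := by
    ext ⟨r, s⟩
    simp only [mem_product, mem_range, mem_insert, mem_expBox, Prod.mk.injEq]
    omega
  rw [this, sum_insert (by simp [mem_expBox])]

theorem sum_piFinset_succ {V α : Type*} [AddCommMonoid V] [DecidableEq α] (s : Finset α) (k : ℕ)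
    (f : (Fin (k + 1) → α) → V) :
    ∑ p ∈ Fintype.piFinset (fun _ : Fin (k + 1) => s), f p =
      ∑ a ∈ s, ∑ q ∈ Fintype.piFinset (fun _ : Fin k => s), f (Fin.cons a q) := by
  rw [← sum_product']
  refine sum_bij' (fun p _ => (p 0, Fin.tail p)) (fun a _ => Fin.cons a.1 a.2) ?_ ?_ ?_ ?_ ?_
  · intro p hp
    rw [Fintype.mem_piFinset] at hp
    exact mem_product.2 ⟨hp 0, Fintype.mem_piFinset.2 fun i => hp i.succ⟩
  · intro a ha
    obtain ⟨h1, h2⟩ := mem_product.1 ha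
    rw [Fintype.mem_piFinset] at h2 ⊢
    exact fun i => Fin.cases h1 h2 i
  · intro p _
    simp
  · intro a _
    simp
  · intro p _
    simp

theorem blockWord_cons {L : Type*} {k : ℕ} (a : ℕ × ℕ) (p : Fin k → ℕ × ℕ) (x y : L) :
    blockWord (Fin.cons a p : Fin (k + 1) → ℕ × ℕ) x y =
      (List.replicate a.1 x ++ List.replicate a.2 y) ++ blockWord p x y := by
  simp [blockWord, List.ofFn_succ]

theorem mem_blockWord {L : Type*} {k : ℕ} {p : Fin k → ℕ × ℕ} {x y a : L}
    (h : a ∈ blockWord p x y) : a = x ∨ a = y := by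
  simp only [blockWord, List.mem_flatten, List.mem_ofFn] at h
  obtain ⟨_, ⟨i, rfl⟩, h⟩ := h
  rcases List.mem_append.1 h with h | h
  · exact Or.inl (List.eq_of_mem_replicate h)
  · exact Or.inr (List.eq_of_mem_replicate h)

theorem exp_mul_exp_eq_sum {R : Type*} [Ring R] [Algebra ℚ R] {X Y : R} {N : ℕ} (hX : X ^ N = 0)
    (hY : Y ^ N = 0) : IsNilpotent.exp X * IsNilpotent.exp Y =
      ∑ a ∈ range N ×ˢ range N, ((a.1.factorial : ℚ) * a.2.factorial)⁻¹ • (X ^ a.1 * Y ^ a.2) := by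
  rw [IsNilpotent.exp_eq_sum hX, IsNilpotent.exp_eq_sum hY, sum_mul_sum, sum_product]
  simp only [smul_mul_smul_comm, mul_inv]

/-- The sum of all brackets of words with `k + 1` blocks is obtained by applying the `k`-th power
of `exp (ad x) * exp (ad y) - 1` to the sum of all brackets of words with one block. -/
theorem sum_iteratedBracket_blockWord (x y : L) {N : ℕ} (hN : 0 < N)
    (hx : LieAlgebra.ad ℚ L x ^ N = 0) (hy : LieAlgebra.ad ℚ L y ^ N = 0) (k : ℕ) :
    ∑ p ∈ Fintype.piFinset (fun _ : Fin (k + 1) => expBox N),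
      (∏ i, (((p i).1.factorial : ℚ) * (p i).2.factorial))⁻¹ • iteratedBracket (blockWord p x y) =
    ((IsNilpotent.exp (LieAlgebra.ad ℚ L x) * IsNilpotent.exp (LieAlgebra.ad ℚ L y) - 1) ^ k)
      (∑ a ∈ expBox N, ((a.1.factorial : ℚ) * a.2.factorial)⁻¹ •
        iteratedBracket (List.replicate a.1 x ++ List.replicate a.2 y)) := by
  induction k with
  | zero =>
    rw [sum_piFinset_succ, pow_zero, Module.End.one_apply]
    refine sum_congr rfl fun a _ => ?_
    simp [blockWord]
  | succ k ih =>
    rw [pow_succ', Module.End.mul_apply, ← ih, sum_piFinset_succ, exp_mul_exp_eq_sum hx hy,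
      sum_range_product_eq_add_expBox hN]
    simp only [pow_zero, Nat.factorial_zero, Nat.cast_one, mul_one, inv_one, one_smul,
      add_sub_cancel_left]
    rw [LinearMap.sum_apply]
    refine sum_congr rfl fun a _ => ?_
    rw [LinearMap.smul_apply, map_sum, smul_sum]
    refine sum_congr rfl fun q hq => ?_
    have hne : blockWord q x y ≠ [] := by
      intro h
      have h1 := length_blockWord q x y
      rw [h, List.length_nil, eq_comm, sum_eq_zero_iff] at h1
      have h2 := mem_expBox.1 (Fintype.mem_piFinset.1 hq 0)
      have h3 := h1 0 (mem_univ _)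
      omega
    rw [blockWord_cons, iteratedBracket_append _ hne, Fin.prod_univ_succ, mul_inv, mul_smul]
    simp

/-- Of the words `x ⋯ x y ⋯ y`, only `x` and `x ⋯ x y` have a non-zero bracket. -/
theorem sum_one_block (x y : L) {N : ℕ} (hN : 2 ≤ N) (hx : LieAlgebra.ad ℚ L x ^ N = 0) :
    ∑ a ∈ expBox N, ((a.1.factorial : ℚ) * a.2.factorial)⁻¹ •
        iteratedBracket (List.replicate a.1 x ++ List.replicate a.2 y) =
      x + IsNilpotent.exp (LieAlgebra.ad ℚ L x) y := by
  obtain ⟨M, rfl⟩ : ∃ M, N = M + 2 := ⟨N - 2, by omega⟩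
  have h0 := sum_range_product_eq_add_expBox (N := M + 2) (by omega) fun a : ℕ × ℕ =>
    ((a.1.factorial : ℚ) * a.2.factorial)⁻¹ •
        iteratedBracket (List.replicate a.1 x ++ List.replicate a.2 y)
  simp only [List.replicate_zero, List.append_nil, iteratedBracket, smul_zero, zero_add] at h0
  rw [← h0, sum_product_right, sum_range_succ', sum_range_succ',
    sum_eq_zero (s := range M) fun s _ => ?_, zero_add, add_comm]
  · congr 1
    · rw [sum_range_succ', sum_range_succ', sum_eq_zero fun r _ => ?_]
      · simp [iteratedBracket]
      · simp [iteratedBracket_replicate_add_two]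
    · rw [IsNilpotent.exp_eq_sum hx, LinearMap.sum_apply]
      refine sum_congr rfl fun r _ => ?_
      rw [iteratedBracket_append _ (by simp)]
      simp [iteratedBracket]
  · refine sum_eq_zero fun r _ => ?_
    rw [iteratedBracket_append _ (by simp), iteratedBracket_replicate_add_two, map_zero, smul_zero]

theorem bchIndex_eq_filter {n N : ℕ} (hn : n < N) (k : ℕ) :
    bchIndex n k = ((Fintype.piFinset fun _ : Fin k => expBox N).filter
      fun p => ∑ i, ((p i).1 + (p i).2) < N).filter fun p => ∑ i, ((p i).1 + (p i).2) = n := by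
  ext p
  simp only [bchIndex, mem_filter, Fintype.mem_piFinset, mem_product, mem_range, mem_expBox]
  refine ⟨fun ⟨h1, h2, h3⟩ => ⟨⟨fun i => ⟨⟨?_, ?_⟩, h2 i⟩, by omega⟩, h3⟩,
    fun ⟨⟨h1, _⟩, h3⟩ => ⟨fun i => ?_, fun i => (h1 i).2, h3⟩⟩
  · have := (h1 i).1
    omega
  · have := (h1 i).2
    omega
  · have := single_le_sum (f := fun i => (p i).1 + (p i).2) (fun _ _ => Nat.zero_le _)
      (mem_univ i)
    omega

theorem bchIndex_eq_empty {n k : ℕ} (h : n < k) : bchIndex n k = ∅ := by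
  refine filter_eq_empty_iff.2 fun p _ hp => ?_
  have := card_nsmul_le_sum univ (fun i => (p i).1 + (p i).2) 1 fun i _ => hp.1 i
  simp only [card_univ, Fintype.card_fin, smul_eq_mul, mul_one] at this
  omega

theorem natCast_smul_bchTerm (x y : L) {n N : ℕ} (hn : n < N) :
    (n : ℚ) • bchTerm ℚ n x y = ∑ k ∈ range N, (choosePoly (k + 1)).coeff 1 •
      ∑ p ∈ bchIndex n (k + 1), (∏ i, (((p i).1.factorial : ℚ) * (p i).2.factorial))⁻¹ •
        iteratedBracket (blockWord p x y) := by
  rcases Nat.eq_zero_or_pos n with rfl | hpos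
  · rw [Nat.cast_zero, zero_smul]
    refine (sum_eq_zero fun k _ => ?_).symm
    rw [bchIndex_eq_empty k.succ_pos, sum_empty, smul_zero]
  have hn0 : (n : ℚ) ≠ 0 := by exact_mod_cast hpos.ne'
  rw [bchTerm, ← sum_subset (range_mono hn.le) fun k _ hk => ?_, smul_sum]
  · rw [range_eq_Ico, sum_Ico_add' (fun k => (choosePoly k).coeff 1 • ∑ p ∈ bchIndex n k,
      (∏ i, (((p i).1.factorial : ℚ) * (p i).2.factorial))⁻¹ • iteratedBracket (blockWord p x y))
      0 n 1, zero_add, Ico_add_one_right_eq_Icc]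
    refine sum_congr rfl fun k _ => ?_
    rw [smul_sum, smul_sum]
    refine sum_congr rfl fun p _ => ?_
    rw [smul_smul, smul_smul, choosePoly_coeff_one]
    congr 1
    field_simp
  · rw [bchIndex_eq_empty (by simpa [Nat.lt_succ_iff] using hk), sum_empty, smul_zero]

theorem bchTerm_eq_zero {K L : Type*} [Field K] [LieRing L] [LieAlgebra K L] {x y : L} {n : ℕ}
    (h : ∀ l : List L, (∀ a ∈ l, a = x ∨ a = y) → l.length = n → iteratedBracket l = 0) :
    bchTerm K n x y = 0 := by
  refine sum_eq_zero fun k _ => sum_eq_zero fun p hp => ?_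
  rw [h _ (fun a ha => ?_) ((length_blockWord p x y).trans (mem_filter.1 hp).2.2), smul_zero]
  exact mem_blockWord ha

theorem bchMul_eq_sum {K L : Type*} [Field K] [LieRing L] [LieAlgebra K L] {x y : L} {N : ℕ}
    (h : ∀ l : List L, (∀ a ∈ l, a = x ∨ a = y) → N ≤ l.length → iteratedBracket l = 0) :
    bchMul K x y = ∑ n ∈ range N, bchTerm K n x y := by
  refine finsum_eq_sum_of_support_subset _ fun n hn => ?_
  by_contra hlt
  have hlt : N ≤ n := by simpa using hlt
  exact hn (bchTerm_eq_zero fun l hl hln => h l hl (hln ▸ hlt))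

/-- Dynkin's series without the weights `1 / n` is the logarithm series of
`exp (ad x) * exp (ad y)`, divided by `exp (ad x) * exp (ad y) - 1` and applied to
`x + exp (ad x) y`. -/
theorem sum_natCast_smul_bchTerm {x y : L} {N : ℕ} (hN : 2 ≤ N)
    (hx : LieAlgebra.ad ℚ L x ^ N = 0) (hy : LieAlgebra.ad ℚ L y ^ N = 0)
    (h : ∀ l : List L, (∀ a ∈ l, a = x ∨ a = y) → N ≤ l.length → iteratedBracket l = 0) :
    ∑ n ∈ range N, (n : ℚ) • bchTerm ℚ n x y = ∑ k ∈ range N, (choosePoly (k + 1)).coeff 1 •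
      ((IsNilpotent.exp (LieAlgebra.ad ℚ L x) * IsNilpotent.exp (LieAlgebra.ad ℚ L y) - 1) ^ k)
        (x + IsNilpotent.exp (LieAlgebra.ad ℚ L x) y) := by
  rw [sum_congr rfl fun n hn => natCast_smul_bchTerm x y (mem_range.1 hn), sum_comm]
  refine sum_congr rfl fun k _ => ?_
  rw [← smul_sum, ← sum_one_block x y hN hx,
    ← sum_iteratedBracket_blockWord x y (by omega) hx hy k,
    sum_congr rfl fun n hn => sum_congr (bchIndex_eq_filter (mem_range.1 hn) (k + 1))
      fun p _ => rfl,
    sum_fiberwise_of_maps_to fun p hp => mem_range.2 (mem_filter.1 hp).2, sum_filter_of_ne]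
  intro p _ hp
  by_contra hlt
  refine hp ?_
  rw [h _ (fun a => mem_blockWord) (by rw [length_blockWord]; omega), smul_zero]

end Dynkin

/-! ### The Baker-Campbell-Hausdorff series under a derivation -/

section Derivation

attribute [local instance] LieRing.ofAssociativeRing

variable {R : Type*} [Ring R] [Algebra ℚ R]

theorem exp_ad_apply {a : R} (ha : IsNilpotent a) (r : R) :
    IsNilpotent.exp (LieAlgebra.ad ℚ R a) r =
      IsNilpotent.exp a * r * IsNilpotent.exp (-a) := by
  have hadd : LieAlgebra.ad ℚ R a = LinearMap.mulLeft ℚ a + LinearMap.mulRight ℚ (-a) := by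
    ext b
    simp [LieRing.of_associative_ring_bracket, sub_eq_add_neg]
  obtain ⟨N, hN⟩ := ha
  have hN' : (-a) ^ N = 0 := by rw [neg_pow, hN, mul_zero]
  have hl : LinearMap.mulLeft ℚ a ^ N = 0 := by
    rw [LinearMap.pow_mulLeft, hN, LinearMap.mulLeft_zero_eq_zero]
  have hr : LinearMap.mulRight ℚ (-a) ^ N = 0 := by
    rw [LinearMap.pow_mulRight, hN', LinearMap.mulRight_zero_eq_zero]
  rw [hadd, IsNilpotent.exp_add_of_commute (LinearMap.commute_mulLeft_right a (-a)) ⟨N, hl⟩ ⟨N, hr⟩,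
    IsNilpotent.exp_eq_sum hl, IsNilpotent.exp_eq_sum hr, IsNilpotent.exp_eq_sum hN,
    IsNilpotent.exp_eq_sum hN', Module.End.mul_apply]
  simp only [LinearMap.sum_apply, LinearMap.smul_apply, LinearMap.pow_mulLeft,
    LinearMap.pow_mulRight, LinearMap.mulLeft_apply, LinearMap.mulRight_apply, sum_mul, mul_sum,
    smul_mul_assoc, mul_smul_comm, map_sum, map_smul, mul_assoc]

theorem derivation_exp (D : R →ₗ[ℚ] R) (hD : ∀ a b, D (a * b) = D a * b + a * D b)
    {x : R} (hx : IsNilpotent x) (hDx : D x = x) :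
    D (IsNilpotent.exp x) = x * IsNilpotent.exp x := by
  have hpow : ∀ k : ℕ, D (x ^ k) = (k : ℚ) • x ^ k := by
    intro k
    induction k with
    | zero => simpa using hD 1 1
    | succ k ih =>
      rw [pow_succ, hD, ih, hDx, smul_mul_assoc, Nat.cast_succ, add_smul, one_smul]
  obtain ⟨N, hN⟩ := hx
  rw [IsNilpotent.exp_eq_sum (k := N + 1) (pow_eq_zero_of_le N.le_succ hN), map_sum,
    sum_range_succ', ← IsNilpotent.exp_eq_sum (k := N + 1) (pow_eq_zero_of_le N.le_succ hN),
    IsNilpotent.exp_eq_sum hN, mul_sum]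
  simp only [map_smul, hpow, Nat.cast_zero, zero_smul, smul_zero, add_zero]
  refine sum_congr rfl fun k _ => ?_
  have hk : ((k + 1 : ℕ) : ℚ) ≠ 0 := by positivity
  rw [smul_smul, Nat.factorial_succ, Nat.cast_mul, mul_inv_rev, mul_assoc, inv_mul_cancel₀ hk,
    mul_one, mul_smul_comm, pow_succ']

theorem derivation_iteratedBracket (D : R →ₗ[ℚ] R)
    (hD : ∀ a b, D (a * b) = D a * b + a * D b) (l : List R) (hl : ∀ a ∈ l, D a = a) :
    D (iteratedBracket l) = (l.length : ℚ) • iteratedBracket l := by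
  induction l with
  | nil => simp [iteratedBracket]
  | cons a l ih =>
    rcases l with _ | ⟨b, l⟩
    · simpa [iteratedBracket] using hl a
    · have h1 := ih fun c hc => hl c (List.mem_cons_of_mem _ hc)
      rw [iteratedBracket, LieRing.of_associative_ring_bracket, map_sub, hD, hD, h1,
        hl a List.mem_cons_self, List.length_cons (a := a), Nat.cast_succ, add_smul, one_smul,
        smul_sub, mul_smul_comm, smul_mul_assoc]
      abel

/-- A derivation that fixes `x` and `y` cancels the weight `1 / n` in Dynkin's formula. -/
theorem derivation_bchTerm (D : R →ₗ[ℚ] R)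
    (hD : ∀ a b, D (a * b) = D a * b + a * D b) {x y : R} (hx : D x = x) (hy : D y = y) (n : ℕ) :
    D (bchTerm ℚ n x y) = (n : ℚ) • bchTerm ℚ n x y := by
  simp only [bchTerm, map_sum, smul_sum]
  refine sum_congr rfl fun k _ => sum_congr rfl fun p hp => ?_
  rw [map_smul, smul_comm, derivation_iteratedBracket D hD,
    (length_blockWord p x y).trans (mem_filter.1 hp).2.2]
  intro a ha
  rcases mem_blockWord ha with rfl | rfl
  exacts [hx, hy]

/-- If a derivation `D` fixes `x` and `y`, then Dynkin's series and `log (exp x * exp y)` have the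
same image under `D`. -/
theorem derivation_bchMul (D : R →ₗ[ℚ] R)
    (hD : ∀ a b, D (a * b) = D a * b + a * D b) {x y : R} (hDx : D x = x) (hDy : D y = y) {N : ℕ}
    (hx : IsNilpotent x) (hy : IsNilpotent y)
    (h : ∀ l : List R, (∀ a ∈ l, a = x ∨ a = y) → N ≤ l.length → iteratedBracket l = 0)
    (hu : IsNilpotent (IsNilpotent.exp x * IsNilpotent.exp y - 1))
    (hS : ((IsNilpotent.exp (LieAlgebra.ad ℚ R x) * IsNilpotent.exp (LieAlgebra.ad ℚ R y) - 1) ^ N)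
        (x + IsNilpotent.exp (LieAlgebra.ad ℚ R x) y) = 0) :
    D (bchMul ℚ x y) = D (nilLog (IsNilpotent.exp x * IsNilpotent.exp y)) := by
  set S := IsNilpotent.exp (LieAlgebra.ad ℚ R x) * IsNilpotent.exp (LieAlgebra.ad ℚ R y) - 1
    with hSdef
  obtain ⟨Nx, hNx⟩ := LieAlgebra.ad_nilpotent_of_nilpotent (R := ℚ) hx
  obtain ⟨Ny, hNy⟩ := LieAlgebra.ad_nilpotent_of_nilpotent (R := ℚ) hy
  obtain ⟨Nu, hNu⟩ := hu
  obtain ⟨M, hM⟩ : ∃ M, M = N + Nx + Ny + Nu + 2 := ⟨_, rfl⟩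
  have hSM : (S ^ M) (x + IsNilpotent.exp (LieAlgebra.ad ℚ R x) y) = 0 := by
    rw [show M = (Nx + Ny + Nu + 2) + N by omega, pow_add, Module.End.mul_apply, hS, map_zero]
  have hlM : ∀ l : List R, (∀ a ∈ l, a = x ∨ a = y) → M ≤ l.length → iteratedBracket l = 0 :=
    fun l hl hlM => h l hl (by omega)
  have hex := IsNilpotent.exp_mul_exp_neg_self hx
  have hey := IsNilpotent.exp_mul_exp_neg_self hy
  have hex' := IsNilpotent.exp_neg_mul_exp_self hx
  have hey' := IsNilpotent.exp_neg_mul_exp_self hy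
  -- the logarithmic derivative of `exp x * exp y`
  have hθ : D (IsNilpotent.exp x * IsNilpotent.exp y) *
      (IsNilpotent.exp (-y) * IsNilpotent.exp (-x)) =
      x + IsNilpotent.exp (LieAlgebra.ad ℚ R x) y := by
    rw [hD, derivation_exp D hD hx hDx, derivation_exp D hD hy hDy, exp_ad_apply hx, add_mul]
    congr 1
    · rw [mul_assoc, mul_assoc, ← mul_assoc _ (IsNilpotent.exp (-y)), hey, one_mul, hex, mul_one]
    · rw [mul_assoc, mul_assoc y, ← mul_assoc _ (IsNilpotent.exp (-y)), hey, one_mul, mul_assoc]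
  rw [bchMul_eq_sum hlM, map_sum, sum_congr rfl fun n _ => derivation_bchTerm D hD hDx hDy n,
    sum_natCast_smul_bchTerm (by omega) (pow_eq_zero_of_le (by omega) hNx)
      (pow_eq_zero_of_le (by omega) hNy) hlM,
    derivation_nilLog (N := M) D hD (v := IsNilpotent.exp (-y) * IsNilpotent.exp (-x)) ?_
      (pow_eq_zero_of_le (by omega) hNu) S ?_ (by rw [hθ, hSM]), hθ]
  · rw [mul_assoc, ← mul_assoc (IsNilpotent.exp (-x)), hex', one_mul, hey']
  · intro r
    rw [hSdef, LinearMap.sub_apply, Module.End.mul_apply, exp_ad_apply hx, exp_ad_apply hy,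
      Module.End.one_apply]
    simp only [mul_assoc]

end Derivation

/-! ### The Baker-Campbell-Hausdorff theorem in filtered associative algebras -/

section Functoriality

variable {K L L' : Type*} [Field K] [LieRing L] [LieAlgebra K L] [LieRing L'] [LieAlgebra K L']

theorem map_iteratedBracket (f : L →ₗ⁅K⁆ L') (l : List L) :
    f (iteratedBracket l) = iteratedBracket (l.map f) := by
  induction l with
  | nil => simp [iteratedBracket]
  | cons a l ih =>
    rcases l with _ | ⟨b, l⟩
    · simp [iteratedBracket]
    · rw [iteratedBracket, LieHom.map_lie, ih]
      simp [iteratedBracket]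

theorem map_bchTerm (f : L →ₗ⁅K⁆ L') (n : ℕ) (x y : L) :
    f (bchTerm K n x y) = bchTerm K n (f x) (f y) := by
  simp only [bchTerm, map_sum, map_smul, map_iteratedBracket]
  simp [blockWord, List.map_ofFn, Function.comp_def, List.map_flatten]

theorem map_bchMul (f : L →ₗ⁅K⁆ L') {x y : L} {N : ℕ}
    (h : ∀ l : List L, (∀ a ∈ l, a = x ∨ a = y) → N ≤ l.length → iteratedBracket l = 0) :
    f (bchMul K x y) = bchMul K (f x) (f y) := by
  rw [bchMul_eq_sum h, bchMul_eq_sum (N := N), map_sum]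
  · simp only [map_bchTerm]
  · intro l hl hlN
    -- a word in `f x` and `f y` is the image of a word in `x` and `y`
    obtain ⟨m, rfl, hm⟩ : ∃ m : List L, m.map f = l ∧ ∀ a ∈ m, a = x ∨ a = y := by
      clear hlN
      induction l with
      | nil => exact ⟨[], rfl, by simp⟩
      | cons b l ih =>
        obtain ⟨m, rfl, hm⟩ := ih fun a ha => hl a (List.mem_cons_of_mem _ ha)
        rcases hl b List.mem_cons_self with rfl | rfl
        · exact ⟨x :: m, rfl, by simpa using hm⟩
        · exact ⟨y :: m, rfl, by simpa using hm⟩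
    rw [← map_iteratedBracket, h m hm (by simpa using hlN), map_zero]

end Functoriality

attribute [local instance] LieRing.ofAssociativeRing

/-- A multiplicative decreasing filtration of finite length on an associative algebra. The zeroth
step contains `1` but need not be everything. -/
structure NilFiltration (R : Type*) [Ring R] [Algebra ℚ R] where
  /-- The steps of the filtration. -/
  step : ℕ → Submodule ℚ R
  one_mem : 1 ∈ step 0
  mul_mem : ∀ {i j a b}, a ∈ step i → b ∈ step j → a * b ∈ step (i + j)
  antitone : Antitone step
  /-- The length of the filtration. -/
  length : ℕ
  step_length : step length = ⊥

namespace NilFiltration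

variable {R : Type*} [Ring R] [Algebra ℚ R] (F : NilFiltration R)

theorem eq_zero {a : R} {n : ℕ} (ha : a ∈ F.step n) (hn : F.length ≤ n) : a = 0 := by
  have := F.antitone hn ha
  rwa [F.step_length, Submodule.mem_bot] at this

theorem pow_mem {a : R} (ha : a ∈ F.step 1) (n : ℕ) : a ^ n ∈ F.step n := by
  induction n with
  | zero => simpa using F.one_mem
  | succ n ih => exact pow_succ a n ▸ F.mul_mem ih ha

theorem pow_length {a : R} (ha : a ∈ F.step 1) : a ^ F.length = 0 :=
  F.eq_zero (F.pow_mem ha _) le_rfl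

theorem isNilpotent {a : R} (ha : a ∈ F.step 1) : IsNilpotent a := ⟨_, F.pow_length ha⟩

theorem exp_sub_one_mem {a : R} (ha : a ∈ F.step 1) : IsNilpotent.exp a - 1 ∈ F.step 1 := by
  rw [IsNilpotent.exp_eq_sum (pow_eq_zero_of_le F.length.le_succ (F.pow_length ha)),
    sum_range_succ']
  simp only [pow_zero, Nat.factorial_zero, Nat.cast_one, inv_one, one_smul, add_sub_cancel_right]
  exact Submodule.sum_mem _ fun k _ => Submodule.smul_mem _ _
    (F.antitone (by omega : 1 ≤ k + 1) (F.pow_mem ha _))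

theorem mem_zero_of_sub_one_mem {u : R} (hu : u - 1 ∈ F.step 1) : u ∈ F.step 0 := by
  simpa using Submodule.add_mem _ (F.antitone zero_le_one hu) F.one_mem

theorem mul_sub_one_mem {u v : R} (hu : u - 1 ∈ F.step 1) (hv : v - 1 ∈ F.step 1) :
    u * v - 1 ∈ F.step 1 := by
  have h : u * v - 1 = (u - 1) * v + (v - 1) := by noncomm_ring
  rw [h]
  exact Submodule.add_mem _ (F.mul_mem hu (F.mem_zero_of_sub_one_mem hv)) hv

theorem nilLog_mem {u : R} (hu : u - 1 ∈ F.step 1) : nilLog u ∈ F.step 1 := by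
  refine Submodule.sum_mem _ fun k _ => ?_
  rcases k with _ | k
  · simp [choosePoly_coeff_one]
  · exact Submodule.smul_mem _ _ (F.antitone (by omega : 1 ≤ k + 1) (F.pow_mem hu _))

theorem iteratedBracket_mem (l : List R) (hl : ∀ a ∈ l, a ∈ F.step 1) :
    iteratedBracket l ∈ F.step l.length := by
  induction l with
  | nil => exact Submodule.zero_mem _
  | cons a l ih =>
    rcases l with _ | ⟨b, l⟩
    · exact hl a List.mem_cons_self
    · have h1 := ih fun c hc => hl c (List.mem_cons_of_mem _ hc)
      have h2 := hl a List.mem_cons_self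
      rw [iteratedBracket, LieRing.of_associative_ring_bracket, List.length_cons (a := a)]
      exact Submodule.sub_mem _ (add_comm 1 _ ▸ F.mul_mem h2 h1) (F.mul_mem h1 h2)

variable {x y : R}

theorem iteratedBracket_eq_zero (hx : x ∈ F.step 1) (hy : y ∈ F.step 1) (l : List R)
    (hl : ∀ a ∈ l, a = x ∨ a = y) (h : F.length ≤ l.length) : iteratedBracket l = 0 := by
  refine F.eq_zero (F.iteratedBracket_mem l fun a ha => ?_) h
  rcases hl a ha with rfl | rfl
  exacts [hx, hy]

theorem bchMul_mem (hx : x ∈ F.step 1) (hy : y ∈ F.step 1) : bchMul ℚ x y ∈ F.step 1 := by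
  rw [bchMul_eq_sum (F.iteratedBracket_eq_zero hx hy)]
  refine Submodule.sum_mem _ fun n _ => Submodule.sum_mem _ fun k hk =>
    Submodule.sum_mem _ fun p hp => Submodule.smul_mem _ _ ?_
  have hlen := (length_blockWord p x y).trans (mem_filter.1 hp).2.2
  have hk := mem_Icc.1 hk
  refine F.antitone (show 1 ≤ (blockWord p x y).length by omega) (F.iteratedBracket_mem _ ?_)
  intro a ha
  rcases mem_blockWord ha with rfl | rfl
  exacts [hx, hy]

theorem exp_ad_sub_mem (hx : x ∈ F.step 1) {r : R} {k : ℕ} (hr : r ∈ F.step k) :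
    IsNilpotent.exp (LieAlgebra.ad ℚ R x) r - r ∈ F.step (k + 1) := by
  have h : ∀ e e' : R, e * r * e' - r = (e - 1) * r * e' + r * (e' - 1) := by
    intros
    noncomm_ring
  have he' := F.exp_sub_one_mem (Submodule.neg_mem _ hx)
  rw [exp_ad_apply (F.isNilpotent hx), h]
  refine Submodule.add_mem _ ?_ (F.mul_mem hr he')
  have := F.mul_mem (F.mul_mem (F.exp_sub_one_mem hx) hr) (F.mem_zero_of_sub_one_mem he')
  rwa [add_zero, add_comm 1 k] at this

theorem exp_ad_mem (hx : x ∈ F.step 1) {r : R} {k : ℕ} (hr : r ∈ F.step k) :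
    IsNilpotent.exp (LieAlgebra.ad ℚ R x) r ∈ F.step k := by
  simpa using Submodule.add_mem _ (F.antitone k.le_succ (F.exp_ad_sub_mem hx hr)) hr

theorem exp_ad_mul_exp_ad_sub_one_pow_mem (hx : x ∈ F.step 1) (hy : y ∈ F.step 1) {r : R}
    {k : ℕ} (hr : r ∈ F.step k) (n : ℕ) :
    ((IsNilpotent.exp (LieAlgebra.ad ℚ R x) * IsNilpotent.exp (LieAlgebra.ad ℚ R y) - 1) ^ n) r ∈
      F.step (k + n) := by
  induction n with
  | zero => simpa using hr
  | succ n ih =>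
    rw [pow_succ', Module.End.mul_apply, ← add_assoc]
    have := Submodule.add_mem _ (F.exp_ad_sub_mem hx (F.exp_ad_mem hy ih)) (F.exp_ad_sub_mem hy ih)
    rwa [sub_add_sub_cancel] at this

/-- The filtration on `R[X]` whose `k`-th step consists of the polynomials with coefficients in the
`k`-th step and without monomials of degree less than `k`. -/
def polynomial : NilFiltration R[X] where
  step k :=
    { carrier := {p | ∀ n, p.coeff n ∈ F.step k ∧ (n < k → p.coeff n = 0)}
      add_mem' := fun {p q} hp hq n => by
        rw [coeff_add]
        exact ⟨Submodule.add_mem _ (hp n).1 (hq n).1, fun h => by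
          rw [(hp n).2 h, (hq n).2 h, add_zero]⟩
      zero_mem' := fun n => by simp
      smul_mem' := fun c p hp n => by
        rw [coeff_smul]
        exact ⟨Submodule.smul_mem _ _ (hp n).1, fun h => by rw [(hp n).2 h, smul_zero]⟩ }
  one_mem n := by
    rw [coeff_one]
    split_ifs
    · exact ⟨F.one_mem, fun h => absurd h n.not_lt_zero⟩
    · exact ⟨Submodule.zero_mem _, fun _ => rfl⟩
  mul_mem {i j p q} hp hq n := by
    rw [coeff_mul]
    refine ⟨Submodule.sum_mem _ fun a _ => F.mul_mem (hp _).1 (hq _).1, fun h =>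
      sum_eq_zero fun a ha => ?_⟩
    have := mem_antidiagonal.1 ha
    rcases lt_or_ge a.1 i with h1 | h1
    · rw [(hp _).2 h1, zero_mul]
    · rw [(hq a.2).2 (by omega), mul_zero]
  antitone _ _ hij p hp n := ⟨F.antitone hij (hp n).1, fun h => (hp n).2 (h.trans_le hij)⟩
  length := F.length
  step_length := by
    refine (Submodule.eq_bot_iff _).2 fun p hp => ?_
    ext n
    simpa using F.eq_zero (hp n).1 le_rfl

theorem monomial_one_mem (hx : x ∈ F.step 1) : monomial 1 x ∈ F.polynomial.step 1 := by
  intro n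
  rw [coeff_monomial]
  split_ifs with h
  · exact ⟨hx, fun h' => by omega⟩
  · exact ⟨Submodule.zero_mem _, fun _ => rfl⟩

end NilFiltration

section

variable {R : Type*} [Ring R] [Algebra ℚ R]

/-- The Euler derivation `X d/dX` on polynomials with coefficients in a noncommutative algebra. -/
noncomputable def eulerDerivation (R : Type*) [Ring R] [Algebra ℚ R] : R[X] →ₗ[ℚ] R[X] where
  toFun p := X * derivative p
  map_add' p q := by rw [derivative_add, mul_add]
  map_smul' c p := by rw [derivative_smul, mul_smul_comm, RingHom.id_apply]

theorem eulerDerivation_mul (p q : R[X]) :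
    eulerDerivation R (p * q) = eulerDerivation R p * q + p * eulerDerivation R q := by
  change X * derivative (p * q) = X * derivative p * q + p * (X * derivative q)
  rw [derivative_mul, mul_add, ← mul_assoc, ← mul_assoc, ← mul_assoc, X_mul (p := p)]

theorem eulerDerivation_monomial_one (x : R) :
    eulerDerivation R (monomial 1 x) = monomial 1 x := by
  change X * derivative (monomial 1 x) = monomial 1 x
  rw [derivative_monomial, X_mul_monomial]
  simp

theorem eq_of_eulerDerivation_eq {p q : R[X]} (hp : p.coeff 0 = 0) (hq : q.coeff 0 = 0)
    (h : eulerDerivation R p = eulerDerivation R q) : p = q := by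
  ext n
  rcases n with _ | n
  · rw [hp, hq]
  · have h1 : (X * derivative p).coeff (n + 1) = (X * derivative q).coeff (n + 1) :=
      congrArg (fun r => coeff r (n + 1)) h
    rw [coeff_X_mul, coeff_X_mul, coeff_derivative, coeff_derivative] at h1
    have h2 : IsUnit ((n : R) + 1) := by
      have h3 : (n : ℚ) + 1 ≠ 0 := by positivity
      simpa using h3.isUnit.map (algebraMap ℚ R)
    exact h2.mul_right_cancel h1

/-- The Baker-Campbell-Hausdorff theorem in an associative algebra. After multiplying `x` and `y` by
a central variable `X`, both `bchMul ℚ x y` and `log (exp x * exp y)` are polynomials without constant term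
that have the same image under the Euler derivation. -/
theorem exp_bchMul (F : NilFiltration R) {x y : R} (hx : x ∈ F.step 1) (hy : y ∈ F.step 1) :
    IsNilpotent.exp (bchMul ℚ x y) = IsNilpotent.exp x * IsNilpotent.exp y := by
  have hX := F.monomial_one_mem hx
  have hY := F.monomial_one_mem hy
  set G := F.polynomial with hG
  have hu := G.mul_sub_one_mem (G.exp_sub_one_mem hX) (G.exp_sub_one_mem hY)
  have key : bchMul ℚ (monomial 1 x) (monomial 1 y) =
      nilLog (IsNilpotent.exp (monomial 1 x) * IsNilpotent.exp (monomial 1 y)) := by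
    refine eq_of_eulerDerivation_eq ((G.bchMul_mem hX hY 0).2 zero_lt_one)
      ((G.nilLog_mem hu 0).2 zero_lt_one) ?_
    refine derivation_bchMul _ eulerDerivation_mul (eulerDerivation_monomial_one x)
      (eulerDerivation_monomial_one y) (G.isNilpotent hX) (G.isNilpotent hY)
      (G.iteratedBracket_eq_zero hX hY) (G.isNilpotent hu) ?_
    exact G.eq_zero (G.exp_ad_mul_exp_ad_sub_one_pow_mem hX hY
      (Submodule.add_mem _ hX (G.exp_ad_mem hX hY)) _) (Nat.le_add_left _ _)
  let ev : R[X] →ₐ[ℚ] R :=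
    (eval₂RingHom' (RingHom.id R) 1 fun a => Commute.one_right a).toRatAlgHom
  have hev : ∀ z, ev (monomial 1 z) = z := fun z => by
    change eval₂ (RingHom.id R) 1 (monomial 1 z) = z
    simp
  have hbch : ev (bchMul ℚ (monomial 1 x) (monomial 1 y)) = bchMul ℚ x y := by
    have := map_bchMul ev.toLieHom (G.iteratedBracket_eq_zero hX hY)
    rw [AlgHom.toLieHom_apply, AlgHom.toLieHom_apply, AlgHom.toLieHom_apply, hev, hev] at this
    exact this
  have h := congrArg ev (congrArg IsNilpotent.exp key)
  rwa [exp_nilLog (G.isNilpotent hu), map_mul,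
    IsNilpotent.map_exp (G.isNilpotent (G.bchMul_mem hX hY)),
    IsNilpotent.map_exp (G.isNilpotent hX), IsNilpotent.map_exp (G.isNilpotent hY), hbch, hev,
    hev] at h

theorem bchMul_assoc_of_nilFiltration (F : NilFiltration R) {x y z : R} (hx : x ∈ F.step 1)
    (hy : y ∈ F.step 1) (hz : z ∈ F.step 1) :
    bchMul ℚ (bchMul ℚ x y) z = bchMul ℚ x (bchMul ℚ y z) := by
  have hxy := F.bchMul_mem hx hy
  have hyz := F.bchMul_mem hy hz
  refine exp_injOn_nilpotent (F.isNilpotent (F.bchMul_mem hxy hz))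
    (F.isNilpotent (F.bchMul_mem hx hyz)) ?_
  rw [exp_bchMul F hxy hz, exp_bchMul F hx hyz, exp_bchMul F hx hy, exp_bchMul F hy hz, mul_assoc]

end

/-! ### Associativity in nilpotent Lie algebras -/

section Nilpotent

variable {g : Type*} [LieRing g] [LieAlgebra ℚ g]

/-- The Lie algebra `ℚ[X] ⊗ g` of polynomial curves in `g`. -/
def Curves (g : Type*) [LieRing g] [LieAlgebra ℚ g] : Type _ := ℚ[X] ⊗[ℚ] g

noncomputable instance : LieRing (Curves g) := inferInstanceAs (LieRing (ℚ[X] ⊗[ℚ] g))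

noncomputable instance : LieAlgebra ℚ (Curves g) := inferInstanceAs (LieAlgebra ℚ (ℚ[X] ⊗[ℚ] g))

/-- The curve with value `p.eval q • a` at `q`. -/
noncomputable def Curves.mk (p : ℚ[X]) (a : g) : Curves g := p ⊗ₜ[ℚ] a

theorem Curves.lie_mk (p q : ℚ[X]) (a b : g) : ⁅mk p a, mk q b⁆ = mk (p * q) ⁅a, b⁆ := rfl

theorem Curves.mk_add (p q : ℚ[X]) (a : g) : mk (p + q) a = mk p a + mk q a :=
  TensorProduct.add_tmul p q a

theorem Curves.mk_zero (p : ℚ[X]) : mk p (0 : g) = 0 := TensorProduct.tmul_zero g p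

@[elab_as_elim]
theorem Curves.induction {P : Curves g → Prop} (ξ : Curves g) (zero : P 0)
    (mk : ∀ p a, P (mk p a)) (add : ∀ ξ ζ, P ξ → P ζ → P (ξ + ζ)) : P ξ :=
  TensorProduct.induction_on ξ zero mk add

/-- The linear map `p ⊗ a ↦ f p • a` induced by a linear functional `f` on `ℚ[X]`. -/
noncomputable def Curves.pairing (f : ℚ[X] →ₗ[ℚ] ℚ) : Curves g →ₗ[ℚ] g :=
  (TensorProduct.lid ℚ g).toLinearMap ∘ₗ LinearMap.rTensor g f

theorem Curves.pairing_mk (f : ℚ[X] →ₗ[ℚ] ℚ) (p : ℚ[X]) (a : g) :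
    pairing f (mk p a) = f p • a := by
  change (TensorProduct.lid ℚ g) (LinearMap.rTensor g f (p ⊗ₜ[ℚ] a)) = _
  rw [LinearMap.rTensor_tmul, TensorProduct.lid_tmul]

/-- The derivation `d/dX` of the Lie algebra of polynomial curves in `g`. -/
noncomputable def curveDerivation (g : Type*) [LieRing g] [LieAlgebra ℚ g] :
    Curves g →ₗ[ℚ] Curves g :=
  LinearMap.rTensor g derivative

theorem curveDerivation_mk (p : ℚ[X]) (a : g) :
    curveDerivation g (Curves.mk p a) = Curves.mk (derivative p) a :=
  LinearMap.rTensor_tmul g derivative a p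

theorem curveDerivation_lie (ξ ζ : Curves g) :
    curveDerivation g ⁅ξ, ζ⁆ = ⁅curveDerivation g ξ, ζ⁆ + ⁅ξ, curveDerivation g ζ⁆ := by
  induction ξ using Curves.induction with
  | zero => simp
  | add ξ₁ ξ₂ h₁ h₂ =>
    simp only [add_lie, map_add, h₁, h₂]
    abel
  | mk p a =>
    induction ζ using Curves.induction with
    | zero => simp
    | add ζ₁ ζ₂ h₁ h₂ =>
      simp only [lie_add, map_add, h₁, h₂]
      abel
    | mk q b => simp only [curveDerivation_mk, Curves.lie_mk, derivative_mul, Curves.mk_add]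

/-- The evaluation of polynomial curves in `g` at `q`. -/
noncomputable def curveEval (g : Type*) [LieRing g] [LieAlgebra ℚ g] (q : ℚ) :
    Curves g →ₗ⁅ℚ⁆ g where
  toLinearMap := Curves.pairing (leval q)
  map_lie' {ξ ζ} := by
    change Curves.pairing (leval q) ⁅ξ, ζ⁆ =
      ⁅Curves.pairing (leval q) ξ, Curves.pairing (leval q) ζ⁆
    induction ξ using Curves.induction with
    | zero => simp
    | add ξ₁ ξ₂ h₁ h₂ => simp only [add_lie, map_add, h₁, h₂]
    | mk p a =>
      induction ζ using Curves.induction with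
      | zero => simp
      | add ζ₁ ζ₂ h₁ h₂ => simp only [lie_add, map_add, h₁, h₂]
      | mk r b =>
        simp only [Curves.lie_mk, Curves.pairing_mk, leval_apply, eval_mul, smul_lie, lie_smul,
          mul_smul]
        exact smul_comm _ _ _

theorem curveEval_mk (q : ℚ) (p : ℚ[X]) (a : g) : curveEval g q (Curves.mk p a) = p.eval q • a :=
  Curves.pairing_mk (leval q) p a

/-- Integration over the interval from `0` to `1` as a linear functional on `ℚ[X]`. -/
noncomputable def unitIntegral : ℚ[X] →ₗ[ℚ] ℚ := lsum fun n => ((n : ℚ) + 1)⁻¹ • LinearMap.id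

theorem unitIntegral_derivative (p : ℚ[X]) :
    unitIntegral (derivative p) = p.eval 1 - p.eval 0 := by
  have h : unitIntegral ∘ₗ derivative = leval (1 : ℚ) - leval 0 := by
    refine lhom_ext' fun n => LinearMap.ext_ring ?_
    rcases n with _ | n
    · simp [leval_apply]
    · have hn : (n : ℚ) + 1 ≠ 0 := by positivity
      rw [LinearMap.comp_apply, LinearMap.comp_apply, derivative_monomial, unitIntegral,
        lsum_apply, sum_monomial_index _ _ (by simp)]
      simp [leval_apply, hn]
  exact LinearMap.congr_fun h p

theorem curveEval_eq_of_curveDerivation_eq_zero {ξ : Curves g}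
    (h : curveDerivation g ξ = 0) : curveEval g 1 ξ = curveEval g 0 ξ := by
  have key : ∀ ξ : Curves g,
      Curves.pairing unitIntegral (curveDerivation g ξ) = curveEval g 1 ξ - curveEval g 0 ξ := by
    intro ξ
    induction ξ using Curves.induction with
    | zero => simp
    | add ξ₁ ξ₂ h₁ h₂ =>
      simp only [map_add, h₁, h₂]
      abel
    | mk p a =>
      rw [curveEval_mk, curveEval_mk, ← sub_smul, ← unitIntegral_derivative, curveDerivation_mk,
        Curves.pairing_mk]
  have := key ξ
  rwa [h, map_zero, eq_comm, sub_eq_zero] at this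

/-- The action of `ξ` on `η + c • d/dX` in the semidirect product of the Lie algebra of polynomial
curves in `g` and the line spanned by its derivation `d/dX`. -/
noncomputable def curveRep (g : Type*) [LieRing g] [LieAlgebra ℚ g] :
    Curves g →ₗ⁅ℚ⁆ Module.End ℚ (Curves g × ℚ) where
  toFun ξ :=
    { toFun := fun v => (⁅ξ, v.1⁆ - v.2 • curveDerivation g ξ, 0)
      map_add' := fun v w => by
        ext
        · simp only [Prod.fst_add, Prod.snd_add, lie_add, add_smul]
          abel
        · simp
      map_smul' := fun c v => by
        ext
        · simp [smul_sub, mul_smul]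
        · simp }
  map_add' ξ ζ := by
    refine LinearMap.ext fun v => Prod.ext ?_ ?_
    · simp only [LinearMap.coe_mk, AddHom.coe_mk, LinearMap.add_apply, Prod.fst_add, add_lie,
        map_add, smul_add]
      abel
    · simp
  map_smul' c ξ := by
    refine LinearMap.ext fun v => Prod.ext ?_ ?_
    · simp [smul_sub, smul_comm c]
    · simp
  map_lie' {ξ ζ} := by
    refine LinearMap.ext fun v => Prod.ext ?_ ?_
    · simp only [LinearMap.coe_mk, AddHom.coe_mk, LieRing.of_associative_ring_bracket,
        LinearMap.sub_apply, Module.End.mul_apply, Prod.fst_sub, curveDerivation_lie, lie_sub,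
        lie_smul, zero_smul, sub_zero, smul_add, lie_lie]
      rw [← lie_skew (curveDerivation g ξ) ζ, smul_neg]
      abel
    · simp [LieRing.of_associative_ring_bracket]

theorem curveRep_apply (ξ : Curves g) (v : Curves g × ℚ) :
    curveRep g ξ v = (⁅ξ, v.1⁆ - v.2 • curveDerivation g ξ, 0) := rfl

/-- The polynomial curves in the `k`-th term of the lower central series of `g`. -/
noncomputable def curveSeries (g : Type*) [LieRing g] [LieAlgebra ℚ g] (k : ℕ) :
    Submodule ℚ (Curves g) :=
  Submodule.span ℚ {ξ | ∃ (p : ℚ[X]) (a : g),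
    a ∈ LieModule.lowerCentralSeries ℚ g g k ∧ Curves.mk p a = ξ}

theorem curveSeries_zero : curveSeries g 0 = ⊤ := by
  refine eq_top_iff.2 fun ξ _ => ?_
  induction ξ using Curves.induction with
  | zero => exact Submodule.zero_mem _
  | add ξ ζ h₁ h₂ => exact Submodule.add_mem _ (h₁ trivial) (h₂ trivial)
  | mk p a => exact Submodule.subset_span ⟨p, a, by simp, rfl⟩

theorem curveSeries_antitone : Antitone (curveSeries g) := fun _ _ hij =>
  Submodule.span_mono fun _ ⟨p, a, ha, h⟩ =>
    ⟨p, a, LieModule.antitone_lowerCentralSeries ℚ g g hij ha, h⟩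

theorem lie_mem_curveSeries (ξ : Curves g) {η : Curves g} {k : ℕ}
    (hη : η ∈ curveSeries g k) : ⁅ξ, η⁆ ∈ curveSeries g (k + 1) := by
  induction hη using Submodule.span_induction with
  | zero => simp
  | add η₁ η₂ _ _ h₁ h₂ => exact lie_add ξ η₁ η₂ ▸ Submodule.add_mem _ h₁ h₂
  | smul c η _ h => exact lie_smul c ξ η ▸ Submodule.smul_mem _ c h
  | mem η hη =>
    obtain ⟨p, a, ha, rfl⟩ := hη
    induction ξ using Curves.induction with
    | zero => simp
    | add ξ₁ ξ₂ h₁ h₂ => exact add_lie ξ₁ ξ₂ (Curves.mk p a) ▸ Submodule.add_mem _ h₁ h₂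
    | mk q b =>
      rw [Curves.lie_mk]
      refine Submodule.subset_span ⟨_, _, ?_, rfl⟩
      rw [LieModule.lowerCentralSeries_succ]
      exact LieSubmodule.lie_mem_lie (LieSubmodule.mem_top b) ha

theorem curveSeries_eq_bot {N : ℕ} (hN : LieModule.lowerCentralSeries ℚ g g N = ⊥) :
    curveSeries g N = ⊥ := by
  refine Submodule.span_eq_bot.2 ?_
  rintro _ ⟨p, a, ha, rfl⟩
  rw [hN, LieSubmodule.mem_bot] at ha
  rw [ha, Curves.mk_zero]

/-- The filtration of the space on which `curveRep g` acts: everything, followed by the lower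
central series of the Lie algebra of polynomial curves. -/
noncomputable def repSeries (g : Type*) [LieRing g] [LieAlgebra ℚ g] :
    ℕ → Submodule ℚ (Curves g × ℚ)
  | 0 => ⊤
  | k + 1 => (curveSeries g k).prod ⊥

theorem repSeries_antitone : Antitone (repSeries g) := by
  refine antitone_nat_of_succ_le fun k => ?_
  rcases k with _ | k
  · exact le_top
  · exact Submodule.prod_mono (curveSeries_antitone k.le_succ) le_rfl

/-- The filtration of the endomorphism algebra by the number of steps by which an endomorphism
moves `repSeries g` down. -/
noncomputable def repFiltration {N : ℕ} (hN : LieModule.lowerCentralSeries ℚ g g N = ⊥) :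
    NilFiltration (Module.End ℚ (Curves g × ℚ)) where
  step k :=
    { carrier := {f | ∀ i, ∀ v ∈ repSeries g i, f v ∈ repSeries g (i + k)}
      add_mem' := fun hf hf' i v hv => Submodule.add_mem _ (hf i v hv) (hf' i v hv)
      zero_mem' := fun i v _ => Submodule.zero_mem _
      smul_mem' := fun c _ hf i v hv => Submodule.smul_mem _ c (hf i v hv) }
  one_mem _ _ hv := hv
  mul_mem {i j a b} ha hb k v hv := by
    have := ha _ _ (hb k v hv)
    rwa [add_assoc, add_comm j i] at this
  antitone _ _ hij _ hf k v hv := repSeries_antitone (Nat.add_le_add_left hij k) (hf k v hv)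
  length := N + 1
  step_length := by
    refine (Submodule.eq_bot_iff _).2 fun f hf => LinearMap.ext fun v => ?_
    have h : f v ∈ repSeries g (0 + (N + 1)) := hf 0 v Submodule.mem_top
    rw [zero_add, repSeries, curveSeries_eq_bot hN, Submodule.prod_bot, Submodule.mem_bot] at h
    exact h

theorem curveRep_mem {N : ℕ} (hN : LieModule.lowerCentralSeries ℚ g g N = ⊥)
    (ξ : Curves g) : curveRep g ξ ∈ (repFiltration hN).step 1 := by
  intro i v hv
  rw [curveRep_apply]
  rcases i with _ | i
  · exact ⟨curveSeries_zero (g := g) ▸ Submodule.mem_top, rfl⟩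
  · have h2 : v.2 = 0 := hv.2
    refine ⟨?_, rfl⟩
    rw [h2, zero_smul, sub_zero]
    exact lie_mem_curveSeries ξ hv.1

theorem iteratedBracket_curve_eq_zero {N : ℕ} (hN : LieModule.lowerCentralSeries ℚ g g N = ⊥)
    (l : List (Curves g)) (hl : N + 1 ≤ l.length) : iteratedBracket l = 0 := by
  have h : iteratedBracket l ∈ curveSeries g (l.length - 1) := by
    clear hl
    induction l with
    | nil => exact Submodule.zero_mem _
    | cons a l ih =>
      rcases l with _ | ⟨b, l⟩
      · exact curveSeries_zero (g := g) ▸ Submodule.mem_top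
      · exact lie_mem_curveSeries a ih
  have := curveSeries_antitone (show N ≤ l.length - 1 by omega) h
  rwa [curveSeries_eq_bot hN, Submodule.mem_bot] at this

theorem bchMul_zero_zero : bchMul ℚ (0 : g) 0 = 0 := by
  refine finsum_eq_zero_of_forall_eq_zero fun n => bchTerm_eq_zero fun l hl _ => ?_
  rcases l with _ | ⟨a, _ | ⟨b, l⟩⟩
  · rfl
  · simpa using! hl a List.mem_cons_self
  · have ha : a = 0 := by simpa using hl a List.mem_cons_self
    rw [iteratedBracket, ha, zero_lie]

/-- The Baker-Campbell-Hausdorff multiplication is associative. The representation `curveRep g`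
shows that the two products of the curves `X ⊗ x`, `X ⊗ y`, `X ⊗ z` have the same derivative; their
values at `0` agree, hence so do their values at `1`. -/
theorem bchMul_assoc_rat [LieRing.IsNilpotent g] (x y z : g) :
    bchMul ℚ (bchMul ℚ x y) z = bchMul ℚ x (bchMul ℚ y z) := by
  obtain ⟨N, hN⟩ := LieModule.IsNilpotent.nilpotent ℚ g g
  have hmap : ∀ {L' : Type _} [LieRing L'] [LieAlgebra ℚ L'] (f : Curves g →ₗ⁅ℚ⁆ L') (ξ ζ),
      f (bchMul ℚ ξ ζ) = bchMul ℚ (f ξ) (f ζ) := fun f _ _ =>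
    map_bchMul f fun l _ hl => iteratedBracket_curve_eq_zero hN l hl
  set a : Curves g := Curves.mk X x with ha
  set b : Curves g := Curves.mk X y with hb
  set c : Curves g := Curves.mk X z with hc
  have hrep : curveRep g (bchMul ℚ (bchMul ℚ a b) c - bchMul ℚ a (bchMul ℚ b c)) = 0 := by
    rw [map_sub, sub_eq_zero, hmap, hmap, hmap, hmap]
    exact bchMul_assoc_of_nilFiltration (repFiltration hN) (curveRep_mem hN a) (curveRep_mem hN b)
      (curveRep_mem hN c)
  have hd := congrArg Prod.fst (LinearMap.congr_fun hrep (0, 1))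
  rw [curveRep_apply] at hd
  simp only [lie_zero, one_smul, zero_sub, LinearMap.zero_apply, Prod.fst_zero, neg_eq_zero] at hd
  have h := curveEval_eq_of_curveDerivation_eq_zero hd
  simp only [map_sub, hmap, ha, hb, hc, curveEval_mk, eval_X, one_smul, zero_smul,
    bchMul_zero_zero, sub_self, sub_eq_zero] at h
  exact h

end Nilpotent

/-! ### The Baker-Campbell-Hausdorff group -/

section Group

variable {K g : Type*} [Field K] [LieRing g] [LieAlgebra K g]

theorem bchTerm_eq_bchTerm_rat [CharZero K] [LieAlgebra ℚ g] (n : ℕ) (x y : g) :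
    bchTerm K n x y = bchTerm ℚ n x y := by
  refine sum_congr rfl fun k _ => sum_congr rfl fun p _ => ?_
  rw [← Rat.cast_smul_eq_qsmul K]
  congr 1
  push_cast
  rfl

theorem bchMul_eq_bchMul_rat [CharZero K] [LieAlgebra ℚ g] (x y : g) :
    bchMul K x y = bchMul ℚ x y := by
  simp only [bchMul, bchTerm_eq_bchTerm_rat]

theorem bchMul_assoc [CharZero K] [LieRing.IsNilpotent g] (x y z : g) :
    bchMul K (bchMul K x y) z = bchMul K x (bchMul K y z) := by
  let _ : Module ℚ g := Module.compHom g (algebraMap ℚ K)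
  let _ : LieAlgebra ℚ g := { lie_smul := fun q a b => lie_smul (algebraMap ℚ K q) a b }
  simp only [bchMul_eq_bchMul_rat]
  exact bchMul_assoc_rat x y z

theorem bchTerm_one (x y : g) : bchTerm K 1 x y = x + y := by
  have h : bchIndex 1 1 = {fun _ => (1, 0), fun _ => (0, 1)} := by decide
  rw [bchTerm, Icc_self, sum_singleton, h, sum_pair]
  · simp [blockWord, iteratedBracket]
  · intro h
    simpa using congrFun h 0

theorem iteratedBracket_eq_zero_of_lie_eq_zero {x y : g} (h : ⁅x, y⁆ = 0) (l : List g)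
    (hl : ∀ a ∈ l, a = x ∨ a = y) (hlen : 2 ≤ l.length) : iteratedBracket l = 0 := by
  have h' : ⁅y, x⁆ = 0 := by rw [← lie_skew, h, neg_zero]
  induction l with
  | nil => rfl
  | cons a l ih =>
    rcases l with _ | ⟨b, _ | ⟨c, l⟩⟩
    · simp at hlen
    · have ha := hl a (by simp)
      have hb := hl b (by simp)
      rcases ha with rfl | rfl <;> rcases hb with rfl | rfl <;> simp [iteratedBracket, h, h']
    · rw [iteratedBracket, ih (fun d hd => hl d (List.mem_cons_of_mem _ hd)) (by simp), lie_zero]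

theorem bchMul_eq_add_of_lie_eq_zero {x y : g} (h : ⁅x, y⁆ = 0) : bchMul K x y = x + y := by
  rw [bchMul_eq_sum (iteratedBracket_eq_zero_of_lie_eq_zero h), sum_range_succ, sum_range_one,
    bchTerm_one]
  simp [bchTerm]

theorem continuous_iteratedBracket [TopologicalSpace K] [TopologicalSpace g]
    [IsTopologicalLieAlgebra K g] {T : Type*} [TopologicalSpace T] (l : List (T → g))
    (hl : ∀ f ∈ l, Continuous f) : Continuous fun t => iteratedBracket (l.map fun f => f t) := by
  induction l with
  | nil => exact continuous_const
  | cons f l ih =>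
    rcases l with _ | ⟨f', l⟩
    · exact hl f List.mem_cons_self
    · have h := ih fun f'' hf => hl f'' (List.mem_cons_of_mem _ hf)
      exact (IsTopologicalLieAlgebra.continuous_lie K (g := g)).comp
        ((hl f List.mem_cons_self).prodMk h)

theorem continuous_bchMul [TopologicalSpace K] [TopologicalSpace g] [IsTopologicalLieAlgebra K g]
    [LieRing.IsNilpotent g] : Continuous fun q : g × g => bchMul K q.1 q.2 := by
  have := IsTopologicalLieAlgebra.isTopologicalAddGroup K (g := g)
  have := IsTopologicalLieAlgebra.continuousSMul (K := K) (g := g)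
  obtain ⟨N, hN⟩ := LieModule.IsNilpotent.nilpotent K g g
  have h0 : ∀ l : List g, N + 1 ≤ l.length → iteratedBracket l = 0 := fun l hl => by
    have h := LieModule.antitone_lowerCentralSeries K g g (show N ≤ l.length - 1 by omega)
      (iteratedBracket_mem_lowerCentralSeries K l)
    rwa [hN, LieSubmodule.mem_bot] at h
  have h1 : (fun q : g × g => bchMul K q.1 q.2) =
      fun q => ∑ n ∈ range (N + 1), bchTerm K n q.1 q.2 :=
    funext fun q => bchMul_eq_sum fun l _ hl => h0 l hl
  rw [h1]
  refine continuous_finsetSum _ fun n _ => continuous_finsetSum _ fun k _ =>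
    continuous_finsetSum _ fun p _ => Continuous.const_smul ?_ _
  have hw : ∀ q : g × g, blockWord p q.1 q.2 =
      (blockWord p (Prod.fst : g × g → g) Prod.snd).map fun f => f q := fun q => by
    simp [blockWord, List.map_ofFn, Function.comp_def, List.map_flatten]
  simp only [hw]
  refine continuous_iteratedBracket (K := K) _ fun f hf => ?_
  rcases mem_blockWord hf with rfl | rfl
  exacts [continuous_fst, continuous_snd]

variable (K g) in
/-- A nilpotent Lie algebra as a group under the Baker-Campbell-Hausdorff multiplication. -/
noncomputable abbrev bchGroup [CharZero K] [LieRing.IsNilpotent g] : Group g where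
  mul := bchMul K
  mul_assoc := bchMul_assoc
  one := 0
  one_mul x := (bchMul_eq_add_of_lie_eq_zero (zero_lie x)).trans (zero_add x)
  mul_one x := (bchMul_eq_add_of_lie_eq_zero (lie_zero x)).trans (add_zero x)
  inv x := -x
  inv_mul_cancel x := (bchMul_eq_add_of_lie_eq_zero (by simp)).trans (neg_add_cancel x)

end Group

end BCH

theorem mainTheorem7 {K g : Type*} [Field K] [CharZero K] [TopologicalSpace K]
    [IsTopologicalDivisionRing K] [T2Space K]
    [LieRing g] [LieAlgebra K g] [TopologicalSpace g] [T2Space g] [IsTopologicalLieAlgebra K g]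
    [LieRing.IsNilpotent g]
    (w : g) (hw : w ∈ LieAlgebra.center K g)
    (φ : g → K) (hφ : Continuous φ) (hφw : ∀ x : g, φ (x + w) = φ x + 1) :
    ∃ grp : Group g,
      (∀ x y : g, grp.mul x y = bchMul K x y) ∧
      grp.one = (0 : g) ∧
      (∀ x : g, grp.inv x = -x) ∧
      ∃ f : g → g, IsTopologicalJGroup g w f := by
  have := IsTopologicalLieAlgebra.isTopologicalAddGroup K (g := g)
  have := IsTopologicalLieAlgebra.continuousSMul (K := K) (g := g)
  have hxw : ∀ x : g, ⁅x, w⁆ = 0 := (LieModule.mem_maxTrivSubmodule K g g w).1 hw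
  have hwx : ∀ x : g, ⁅w, x⁆ = 0 := fun x => by rw [← lie_skew, hxw, neg_zero]
  let _ := BCH.bchGroup K g
  -- For `x = u + t • w` with `t = φ x`, the translation by `w` fixes `u = x - φ x • w` and moves
  -- `t` to `t + 1`; `f x = t • u + (t * (t - 1) / 2) • w` then satisfies `f (x + w) = f x + x`.
  refine ⟨BCH.bchGroup K g, fun _ _ => rfl, rfl, fun _ => rfl,
    fun x => φ x • x - (φ x * (φ x + 1) / 2) • w, ⟨?_, inferInstance, ?_, fun x => ?_⟩⟩
  · exact { continuous_mul := BCH.continuous_bchMul, continuous_inv := continuous_neg }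
  · exact (hφ.smul continuous_id).sub
      (((hφ.mul (hφ.add continuous_const)).div_const 2).smul continuous_const)
  · have h1 : x * w = x + w := BCH.bchMul_eq_add_of_lie_eq_zero (hxw x)
    have h2 : (φ x • x - (φ x * (φ x + 1) / 2) • w) * x =
        φ x • x - (φ x * (φ x + 1) / 2) • w + x :=
      BCH.bchMul_eq_add_of_lie_eq_zero (by simp [hwx])
    rw [h2]
    simp only [h1, hφw]
    match_scalars
    · ring
    · field_simp
      ring
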